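/- Let $P$ be a finite-dimensional linear time-invariant plant with $n_u$ inputs and $n_y$ outputs and real state-space representation $(A_P,B_P,C_P,D_P)$. Controllers are finite-dimensional linear time-invariant systems $K$ with $n_y$ inputs and $n_u$ outputs, given by real state-space representations $(A_K,B_K,C_K,D_K)$ of arbitrary finite order, with (proper, real rational) transfer matrix $K(\sigma)=C_K(\sigma I-A_K)^{-1}B_K+D_K$. For a controller with $I-D_KD_P$ invertible (a well-posed closed loop), put $M=(I-D_KD_P)^{-1}$, $N=(I-D_PD_K)^{-1}$ and $$A_{\mathrm{CL}}(P,K)=\begin{pmatrix} A_P+B_PMD_KC_P & B_PMC_K\\ B_KNC_P & A_K+B_KD_PMC_K\end{pmatrix}.$$ Let $\mathrm{Adm}\subseteq\{1,\dots,n_u\}\times\{1,\dots,n_y\}$ be a set of admissible indices, and let $\mathcal S$ be the set of controllers with $K_{kl}(\sigma)=0$ for all $(k,l)\notin \mathrm{Adm}$. For a set $I$ of $k$ indices let $\mathcal T^{\mathrm{s}+k}_I$ ("static plus $k$") be the set of controllers such that $K_{kl}(\sigma)$ is a real constant for every $(k,l)\notin I$, while the entries with index in $I$ may be arbitrary proper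 real rational functions. For a set $\mathcal T$ of controllers, the set of fixed modes of $P$ with respect to $\mathcal S$ and $\mathcal T$ is $$\mathrm{FM}(P,\mathcal S,\mathcal T)=\bigcap_{K}\ \mathrm{eig}\bigl(A_{\mathrm{CL}}(P,K)\bigr)\subseteq\mathbb C,$$ the intersection being over all $K\in\mathcal S\cap\mathcal T$ with $I-D_KD_P$ invertible. Theorem. Let $I_k\subseteq\mathrm{Adm}$ be a set of $k$ indices, let $(i,j)\in\mathrm{Adm}\setminus I_k$, and put $I_{k+1}=I_k\cup\{(i,j)\}$. Then $$\mathrm{FM}\bigl(P,\mathcal S,\mathcal T^{\mathrm{s}+k}_{I_k}\bigr)=\mathrm{FM}\bigl(P,\mathcal S,\mathcal T^{\mathrm{s}+(k+1)}_{I_{k+1}}\bigr).$$ -/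

import Mathlib

/-- A finite-dimensional linear time-invariant system with `m` inputs and `p` outputs, given by a
real state-space representation `(A, B, C, D)` of arbitrary finite order `n`. -/
structure LTISystem (m p : ℕ) where
  /-- the order (number of states) -/
  n : ℕ
  A : Matrix (Fin n) (Fin n) ℝ
  B : Matrix (Fin n) (Fin m) ℝ
  C : Matrix (Fin p) (Fin n) ℝ
  D : Matrix (Fin p) (Fin m) ℝ

namespace LTISystem

/-- The transfer matrix `C (σ I - A)⁻¹ B + D`, with entries in the field `ℝ(σ)` of real rational
functions.  The matrix `σ I - A` is always invertible over `ℝ(σ)`. -/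
noncomputable def transferMatrix {m p : ℕ} (K : LTISystem m p) :
    Matrix (Fin p) (Fin m) (RatFunc ℝ) :=
  K.C.map RatFunc.C
      * (Matrix.scalar (Fin K.n) (RatFunc.X : RatFunc ℝ) - K.A.map RatFunc.C)⁻¹
      * K.B.map RatFunc.C
    + K.D.map RatFunc.C

end LTISystem

/-- The information constraint `𝒮` with set of admissible indices `Adm`: controllers all of whose
transfer matrix entries outside `Adm` vanish.  A controller for a plant with `nu` inputs and `ny`
outputs has `ny` inputs and `nu` outputs. -/
def sparsityConstraint {nu ny : ℕ} (Adm : Finset (Fin nu × Fin ny)) : Set (LTISystem ny nu) :=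
  {K | ∀ i j, (i, j) ∉ Adm → K.transferMatrix i j = 0}

/-- The controller type "static plus `k`" for an index set `I` with `k` elements: every entry of
the transfer matrix outside `I` is a real constant, while the entries in `I` may be dynamic (they
are proper rational functions, as are all entries of the transfer matrix of an `LTISystem`). -/
def staticPlus {nu ny : ℕ} (I : Finset (Fin nu × Fin ny)) : Set (LTISystem ny nu) :=
  {K | ∀ i j, (i, j) ∉ I → ∃ r : ℝ, K.transferMatrix i j = RatFunc.C r}

/-- The feedback interconnection of `P` and `K` is well posed: `I - D_K D_P` is invertible
(equivalently, `I - D_P D_K` is). -/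
def WellPosed {nu ny : ℕ} (P : LTISystem nu ny) (K : LTISystem ny nu) : Prop :=
  IsUnit (1 - K.D * P.D)

/-- The dynamics matrix `A_CL(P, K)` of the closed loop, with `M = (I - D_K D_P)⁻¹` and
`N = (I - D_P D_K)⁻¹`.  It is meaningful only if the interconnection is well posed. -/
noncomputable def closedLoopA {nu ny : ℕ} (P : LTISystem nu ny) (K : LTISystem ny nu) :
    Matrix (Fin P.n ⊕ Fin K.n) (Fin P.n ⊕ Fin K.n) ℝ :=
  let M : Matrix (Fin nu) (Fin nu) ℝ := (1 - K.D * P.D)⁻¹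
  let N : Matrix (Fin ny) (Fin ny) ℝ := (1 - P.D * K.D)⁻¹
  Matrix.fromBlocks
    (P.A + P.B * M * K.D * P.C) (P.B * M * K.C)
    (K.B * N * P.C) (K.A + K.B * P.D * M * K.C)

/-- The set of complex eigenvalues of a real square matrix. -/
noncomputable def eigs {ι : Type} [Fintype ι] [DecidableEq ι] (A : Matrix ι ι ℝ) : Set ℂ :=
  spectrum ℂ (A.map (algebraMap ℝ ℂ))

/-- The fixed modes of the plant `P` with respect to an information constraint `S` and a controller
type `T`: the complex numbers that are eigenvalues of `A_CL(P, K)` for every `K ∈ S ∩ T` for which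
the closed loop is defined. -/
def fixedModes {nu ny : ℕ} (P : LTISystem nu ny) (S T : Set (LTISystem ny nu)) : Set ℂ :=
  {l | ∀ K ∈ S ∩ T, WellPosed P K → l ∈ eigs (closedLoopA P K)}

/-!
One inclusion is monotonicity in the controller type.  For the other one, let `K` be a controller
of type "static plus `I ∪ {(i, j)}`" for which the complex number `l` is *not* a closed-loop
eigenvalue; a controller with a constant `(i, j)` entry and the same property has to be found.

* Replacing `A_K` by `A_K + ε I` replaces `K(σ)` by `K(σ - ε)`, which respects both the sparsity
  pattern and the constant entries (`LTISystem.shift`).  All but finitely many `ε` keep `l` out of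
  the closed-loop spectrum and move the poles of `K` off `l`.  So `K(l)` may be assumed to be
  defined.
* Then `l` is a closed-loop eigenvalue if and only if a certain determinant, which depends on the
  controller only through the matrix `K(l)`, vanishes (`det_closedLoop_mul_det`).
* The `(i, j)` entry of `K(σ)` is exchanged for a real constant `r` by a realization which again
  has no pole at `l` (`LTISystem.replaceEntry`).  The determinant becomes a polynomial in `r`.  It
  is not identically zero, since the complex value `r = K(l) i j` gives the determinant that belongs
  to `K`.  Hence all but finitely many real `r` keep `l` out of the closed-loop spectrum and the
  interconnection well posed.

All three perturbations are affine in one parameter, and `Matrix.finite_setOf_det_add_smul_eq_zero`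
bounds the exceptional parameters.
-/

/-! ### Determinants and inverses of matrices -/

/-- A pencil of square matrices that is nonsingular at one parameter is singular at only finitely
many. -/
theorem Matrix.finite_setOf_det_add_smul_eq_zero {ι F : Type*} [Fintype ι] [DecidableEq ι] [Field F]
    (X Y : Matrix ι ι F) (t₀ : F) (h : (X + t₀ • Y).det ≠ 0) :
    {t : F | (X + t • Y).det = 0}.Finite := by
  classical
  set p : Polynomial F :=
    (X.map Polynomial.C + (Polynomial.X : Polynomial F) • Y.map Polynomial.C).det with hp
  have heval : ∀ t, p.eval t = (X + t • Y).det := by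
    intro t
    rw [hp, ← Polynomial.coe_evalRingHom, RingHom.map_det]
    congr 1
    ext a b
    simpa using mul_comm _ _
  have hp0 : p ≠ 0 := by
    intro h0
    apply h
    rw [← heval, h0, Polynomial.eval_zero]
  refine (p.roots.toFinset.finite_toSet).subset fun t ht => ?_
  have ht' : p.eval t = 0 := (heval t).trans ht
  simpa [hp0] using ht'

theorem Matrix.map_nonsing_inv {ι F E : Type*} [Fintype ι] [DecidableEq ι] [Field F] [Field E]
    (f : F →+* E) (A : Matrix ι ι F) : A⁻¹.map f = (A.map f)⁻¹ := by
  have h1 : (A.map f).det = f A.det := (f.map_det A).symm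
  have h2 : (A.map f).adjugate = A.adjugate.map f := (f.map_adjugate A).symm
  rw [Matrix.inv_def, Matrix.inv_def, h1, h2, Ring.inverse_eq_inv', Ring.inverse_eq_inv',
    ← map_inv₀]
  ext a b
  simp

theorem Matrix.scalar_sub_submatrix {R ν μ : Type*} [CommRing R] [Fintype ν] [DecidableEq ν]
    [Fintype μ] [DecidableEq μ] (e : μ ≃ ν) (s : R) (A : Matrix ν ν R) :
    Matrix.scalar μ s - A.submatrix e e = (Matrix.scalar ν s - A).submatrix e e := by
  ext a b
  by_cases hab : a = b <;> simp [Matrix.diagonal, hab]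

theorem Matrix.scalar_sub_fromBlocks_diagonal {R ν μ : Type*} [CommRing R] [Fintype ν]
    [DecidableEq ν] [Fintype μ] [DecidableEq μ] (s : R) (A : Matrix ν ν R) (B : Matrix μ μ R) :
    Matrix.scalar (ν ⊕ μ) s - Matrix.fromBlocks A 0 0 B
      = Matrix.fromBlocks (Matrix.scalar ν s - A) 0 0 (Matrix.scalar μ s - B) := by
  ext (a | a) (b | b)
  · by_cases hab : a = b <;> simp [Matrix.diagonal, hab]
  · simp [Matrix.diagonal]
  · simp [Matrix.diagonal]
  · by_cases hab : a = b <;> simp [Matrix.diagonal, hab]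

/-! ### Frequency responses -/

/-- The matrix `C (s I - A)⁻¹ B + D`.  It is meaningful only if `s I - A` is invertible. -/
noncomputable def freqResp {R : Type*} [CommRing R] {ν m p : Type*} [Fintype ν] [DecidableEq ν]
    (s : R) (A : Matrix ν ν R) (B : Matrix ν m R) (C : Matrix p ν R) (D : Matrix p m R) :
    Matrix p m R :=
  C * (Matrix.scalar ν s - A)⁻¹ * B + D

theorem freqResp_map {F E : Type*} [Field F] [Field E] {ν m p : Type*} [Fintype ν]
    [DecidableEq ν] (f : F →+* E) (s : F) (A : Matrix ν ν F) (B : Matrix ν m F)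
    (C : Matrix p ν F) (D : Matrix p m F) :
    (freqResp s A B C D).map f = freqResp (f s) (A.map f) (B.map f) (C.map f) (D.map f) := by
  have h : (Matrix.scalar ν s - A).map f = Matrix.scalar ν (f s) - A.map f := by
    ext a b
    by_cases hab : a = b <;> simp [Matrix.diagonal, hab]
  simp only [freqResp, Matrix.map_add f (map_add f), Matrix.map_mul, Matrix.map_nonsing_inv, h]

theorem freqResp_reindex {R : Type*} [CommRing R] {ν μ m p : Type*} [Fintype ν] [DecidableEq ν]
    [Fintype μ] [DecidableEq μ] (e : μ ≃ ν) (s : R) (A : Matrix ν ν R) (B : Matrix ν m R)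
    (C : Matrix p ν R) (D : Matrix p m R) :
    freqResp s (A.submatrix e e) (B.submatrix e id) (C.submatrix id e) D
      = freqResp s A B C D := by
  rw [freqResp, freqResp, Matrix.scalar_sub_submatrix, Matrix.inv_submatrix_equiv,
    Matrix.submatrix_mul_equiv, Matrix.submatrix_mul_equiv, Matrix.submatrix_id_id]

/-- The system with two copies of the state of `(A, B, C, D)`, the second of which removes the
strictly proper part of the `(i, j)` entry of the response.  No invertibility is needed: if
`s I - A` is singular, its inverse and that of the block matrix are both zero. -/
theorem freqResp_fromBlocks {R : Type*} [CommRing R] {ν m p : Type*} [Fintype ν] [DecidableEq ν]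
    [Fintype m] [DecidableEq m] [Fintype p] [DecidableEq p] (s : R) (A : Matrix ν ν R)
    (B : Matrix ν m R) (C : Matrix p ν R) (D : Matrix p m R) (i : p) (j : m) (t : R) :
    freqResp s (Matrix.fromBlocks A 0 0 A) (Matrix.fromRows B (B * Matrix.single j j (1 : R)))
        (Matrix.fromCols C (-(Matrix.single i i (1 : R) * C))) (D + t • Matrix.single i j (1 : R))
      = freqResp s A B C D + (t - (freqResp s A B C D i j - D i j)) • Matrix.single i j (1 : R) := by
  have h1 : Matrix.single i i (1 : R) * (C * (Matrix.scalar ν s - A)⁻¹ * B)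
        * Matrix.single j j (1 : R)
      = (freqResp s A B C D i j - D i j) • Matrix.single i j (1 : R) := by
    rw [Matrix.single_mul_mul_single, Matrix.smul_single]
    simp [freqResp]
  rw [sub_smul, ← h1, freqResp, Matrix.scalar_sub_fromBlocks_diagonal,
    Matrix.inv_fromBlocks_zero₂₁_of_isUnit_iff _ _ _ Iff.rfl, Matrix.fromCols_mul_fromBlocks,
    Matrix.fromCols_mul_fromRows, freqResp]
  simp only [Matrix.mul_zero, Matrix.zero_mul, neg_zero, add_zero, zero_add, Matrix.neg_mul,
    Matrix.mul_assoc]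
  abel

/-! ### The closed-loop determinant -/

/-- The coefficient matrix of the loop equations `A x = B u`, `u = G (C x + D u)`, with the plant
state `x` and the controller output `u` as unknowns.  Here `B`, `C`, `D` belong to the plant, `A`
stands for the matrix `l I - A_P`, and `G` for the value of the controller at `l`. -/
def loopMatrix {R : Type*} [CommRing R] {ν m p : Type*} [Fintype m] [DecidableEq m] [Fintype p]
    (A : Matrix ν ν R) (B : Matrix ν m R) (C : Matrix p ν R) (D : Matrix p m R)
    (G : Matrix m p R) : Matrix (ν ⊕ m) (ν ⊕ m) R :=
  Matrix.fromBlocks A (-B) (-(G * C)) (1 - G * D)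

theorem loopMatrix_add_smul {R : Type*} [CommRing R] {ν m p : Type*} [Fintype m] [DecidableEq m]
    [Fintype p] (A : Matrix ν ν R) (B : Matrix ν m R) (C : Matrix p ν R) (D : Matrix p m R)
    (G H : Matrix m p R) (t : R) :
    loopMatrix A B C D (G + t • H)
      = loopMatrix A B C D G + t • Matrix.fromBlocks 0 0 (-(H * C)) (-(H * D)) := by
  rw [loopMatrix, loopMatrix, Matrix.fromBlocks_smul, Matrix.fromBlocks_add]
  congr 1
  · simp
  · simp
  · simp only [Matrix.add_mul, Matrix.smul_mul, smul_neg]; abel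
  · simp only [Matrix.add_mul, Matrix.smul_mul, smul_neg]; abel

/-- Both sides compute the determinant of the loop equations in the unknowns `x`, `z` (the states
of plant and controller) and `u` (the controller output): on the left `u` is eliminated first, on
the right `z`. -/
theorem det_closedLoop_mul_det {R : Type*} [CommRing R] {ν μ m p : Type*} [Fintype ν]
    [DecidableEq ν] [Fintype μ] [DecidableEq μ] [Fintype m] [DecidableEq m] [Fintype p]
    [DecidableEq p] (l : R) (A : Matrix ν ν R) (B : Matrix ν m R) (C : Matrix p ν R)
    (D : Matrix p m R) (a : Matrix μ μ R) (b : Matrix μ p R) (c : Matrix m μ R) (d : Matrix m p R)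
    (hd : IsUnit (1 - d * D)) (ha : IsUnit (Matrix.scalar μ l - a)) :
    (Matrix.scalar (ν ⊕ μ) l - Matrix.fromBlocks
        (A + B * (1 - d * D)⁻¹ * d * C) (B * (1 - d * D)⁻¹ * c)
        (b * (1 - D * d)⁻¹ * C) (a + b * D * (1 - d * D)⁻¹ * c)).det * (1 - d * D).det
      = (Matrix.scalar μ l - a).det
        * (loopMatrix (Matrix.scalar ν l - A) B C D (freqResp l a b c d)).det := by
  -- the push-through identity expresses `N` by `M`
  have hN : (1 - D * d)⁻¹ = 1 + D * (1 - d * D)⁻¹ * d := by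
    apply Matrix.inv_eq_right_inv
    have h := Matrix.mul_nonsing_inv _ ((Matrix.isUnit_iff_isUnit_det _).1 hd)
    calc (1 - D * d) * (1 + D * (1 - d * D)⁻¹ * d)
        = 1 - D * d + D * ((1 - d * D) * (1 - d * D)⁻¹) * d := by
          simp only [Matrix.sub_mul, Matrix.mul_sub, Matrix.mul_add, Matrix.mul_one,
            Matrix.one_mul, Matrix.mul_assoc]
      _ = 1 := by rw [h]; simp
  let := hd.invertible
  let := ha.invertible
  -- the loop equations in the unknowns `(x, z)` and `u`
  set W : Matrix ((ν ⊕ μ) ⊕ m) ((ν ⊕ μ) ⊕ m) R := Matrix.fromBlocks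
    (Matrix.fromBlocks (Matrix.scalar ν l - A) 0 (-(b * C)) (Matrix.scalar μ l - a))
    (Matrix.fromRows (-B) (-(b * D))) (Matrix.fromCols (-(d * C)) (-c)) (1 - d * D) with hW
  have h1 := Matrix.det_fromBlocks₂₂
    (Matrix.fromBlocks (Matrix.scalar ν l - A) 0 (-(b * C)) (Matrix.scalar μ l - a))
    (Matrix.fromRows (-B) (-(b * D))) (Matrix.fromCols (-(d * C)) (-c)) (1 - d * D)
  have h2 := Matrix.det_fromBlocks₂₂
    (Matrix.fromBlocks (Matrix.scalar ν l - A) (-B) (-(d * C)) (1 - d * D))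
    (Matrix.fromRows 0 (-c)) (Matrix.fromCols (-(b * C)) (-(b * D))) (Matrix.scalar μ l - a)
  -- the same equations in the unknowns `(x, u)` and `z`
  have h3 : W.det = (Matrix.fromBlocks
      (Matrix.fromBlocks (Matrix.scalar ν l - A) (-B) (-(d * C)) (1 - d * D))
      (Matrix.fromRows 0 (-c)) (Matrix.fromCols (-(b * C)) (-(b * D)))
      (Matrix.scalar μ l - a)).det := by
    rw [← Matrix.det_submatrix_equiv_self
      (((Equiv.sumAssoc ν m μ).trans ((Equiv.refl ν).sumCongr (Equiv.sumComm m μ))).trans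
        (Equiv.sumAssoc ν μ m).symm) W]
    congr 1
    ext ((r | r) | r) ((q | q) | q) <;> rfl
  -- the Schur complement of the `u` block is the closed-loop dynamics
  have h4 : Matrix.scalar (ν ⊕ μ) l - Matrix.fromBlocks
        (A + B * (1 - d * D)⁻¹ * d * C) (B * (1 - d * D)⁻¹ * c)
        (b * (1 - D * d)⁻¹ * C) (a + b * D * (1 - d * D)⁻¹ * c)
      = Matrix.fromBlocks (Matrix.scalar ν l - A) 0 (-(b * C)) (Matrix.scalar μ l - a)
        - Matrix.fromRows (-B) (-(b * D)) * ⅟(1 - d * D) * Matrix.fromCols (-(d * C)) (-c) := by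
    have hs : Matrix.scalar (ν ⊕ μ) l
        = Matrix.fromBlocks (Matrix.scalar ν l) 0 0 (Matrix.scalar μ l) := by
      simp [Matrix.scalar_apply, Matrix.fromBlocks_diagonal]
    rw [hN, Matrix.invOf_eq_nonsing_inv, Matrix.fromRows_mul, Matrix.fromRows_mul_fromCols, hs,
      sub_eq_add_neg (Matrix.fromBlocks _ _ _ _), sub_eq_add_neg (Matrix.fromBlocks _ _ _ _),
      Matrix.fromBlocks_neg, Matrix.fromBlocks_neg, Matrix.fromBlocks_add, Matrix.fromBlocks_add]
    congr 1 <;>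
    · simp only [Matrix.neg_mul, Matrix.mul_neg, neg_neg, Matrix.mul_add, Matrix.add_mul,
        Matrix.mul_assoc, Matrix.mul_one, neg_add, sub_eq_add_neg]
      try abel
  -- the Schur complement of the `z` block sees the controller only through its response
  have h5 : loopMatrix (Matrix.scalar ν l - A) B C D (freqResp l a b c d)
      = Matrix.fromBlocks (Matrix.scalar ν l - A) (-B) (-(d * C)) (1 - d * D)
        - Matrix.fromRows 0 (-c) * ⅟(Matrix.scalar μ l - a)
          * Matrix.fromCols (-(b * C)) (-(b * D)) := by
    rw [loopMatrix, freqResp, Matrix.invOf_eq_nonsing_inv, Matrix.fromRows_mul,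
      Matrix.fromRows_mul_fromCols, sub_eq_add_neg (Matrix.fromBlocks _ _ _ _),
      Matrix.fromBlocks_neg, Matrix.fromBlocks_add]
    congr 1 <;>
    · simp only [Matrix.neg_mul, Matrix.mul_neg, neg_neg, Matrix.add_mul, Matrix.zero_mul,
        Matrix.mul_assoc]
      abel
  rw [h4, h5, mul_comm, ← h1, ← hW, h3, h2]

/-! ### Closed-loop eigenvalues -/

theorem transferMatrix_eq_freqResp {m p : ℕ} (K : LTISystem m p) :
    K.transferMatrix = freqResp RatFunc.X (K.A.map RatFunc.C) (K.B.map RatFunc.C)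
      (K.C.map RatFunc.C) (K.D.map RatFunc.C) := rfl

theorem notMem_eigs_iff {ι : Type} [Fintype ι] [DecidableEq ι] (A : Matrix ι ι ℝ) (l : ℂ) :
    l ∉ eigs A ↔ (Matrix.scalar ι l - A.map (algebraMap ℝ ℂ)).det ≠ 0 := by
  rw [eigs, spectrum.notMem_iff, Matrix.isUnit_iff_isUnit_det, isUnit_iff_ne_zero]
  rfl

namespace LTISystem

/-- The value `K(l)` of the transfer matrix at a complex number, computed from the realization.
It is meaningful only if `l` is not an eigenvalue of `K.A`. -/
noncomputable def evalAt {m p : ℕ} (K : LTISystem m p) (l : ℂ) : Matrix (Fin p) (Fin m) ℂ :=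
  freqResp l (K.A.map (algebraMap ℝ ℂ)) (K.B.map (algebraMap ℝ ℂ)) (K.C.map (algebraMap ℝ ℂ))
    (K.D.map (algebraMap ℝ ℂ))

/-- The loop matrix of a plant `P` at the complex number `l`, with `G` as value of the
controller. -/
noncomputable def loopAt {nu ny : ℕ} (P : LTISystem nu ny) (l : ℂ)
    (G : Matrix (Fin nu) (Fin ny) ℂ) : Matrix (Fin P.n ⊕ Fin nu) (Fin P.n ⊕ Fin nu) ℂ :=
  loopMatrix (Matrix.scalar (Fin P.n) l - P.A.map (algebraMap ℝ ℂ)) (P.B.map (algebraMap ℝ ℂ))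
    (P.C.map (algebraMap ℝ ℂ)) (P.D.map (algebraMap ℝ ℂ)) G

/-- Away from the poles of the controller, being a closed-loop eigenvalue depends on the controller
only through the value of its transfer matrix. -/
theorem notMem_eigs_closedLoopA_iff {nu ny : ℕ} (P : LTISystem nu ny) (K : LTISystem ny nu) (l : ℂ)
    (hwp : WellPosed P K) (hl : l ∉ eigs K.A) :
    l ∉ eigs (closedLoopA P K) ↔ (P.loopAt l (K.evalAt l)).det ≠ 0 := by
  set f := algebraMap ℝ ℂ with hf
  have hD : 1 - K.D.map f * P.D.map f = (1 - K.D * P.D).map f := by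
    rw [Matrix.map_sub f (map_sub f), Matrix.map_mul, Matrix.map_one f (map_zero f) (map_one f)]
  have hD' : 1 - P.D.map f * K.D.map f = (1 - P.D * K.D).map f := by
    rw [Matrix.map_sub f (map_sub f), Matrix.map_mul, Matrix.map_one f (map_zero f) (map_one f)]
  have hd : IsUnit (1 - K.D.map f * P.D.map f) := by
    rw [hD]
    exact hwp.map f.mapMatrix
  rw [notMem_eigs_iff] at hl ⊢
  have ha : IsUnit (Matrix.scalar (Fin K.n) l - K.A.map f) := by
    rw [Matrix.isUnit_iff_isUnit_det]
    exact hl.isUnit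
  have hd0 : (1 - K.D.map f * P.D.map f).det ≠ 0 :=
    ((Matrix.isUnit_iff_isUnit_det _).1 hd).ne_zero
  have key := det_closedLoop_mul_det l (P.A.map f) (P.B.map f) (P.C.map f) (P.D.map f)
    (K.A.map f) (K.B.map f) (K.C.map f) (K.D.map f) hd ha
  have hcl : (closedLoopA P K).map f = Matrix.fromBlocks
      (P.A.map f + P.B.map f * (1 - K.D.map f * P.D.map f)⁻¹ * K.D.map f * P.C.map f)
      (P.B.map f * (1 - K.D.map f * P.D.map f)⁻¹ * K.C.map f)
      (K.B.map f * (1 - P.D.map f * K.D.map f)⁻¹ * P.C.map f)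
      (K.A.map f + K.B.map f * P.D.map f * (1 - K.D.map f * P.D.map f)⁻¹ * K.C.map f) := by
    rw [hD, hD', closedLoopA, Matrix.fromBlocks_map]
    simp only [Matrix.map_add f (map_add f), Matrix.map_mul, Matrix.map_nonsing_inv]
  rw [hcl, loopAt, evalAt]
  constructor
  · intro h h0
    rw [h0, mul_zero] at key
    exact mul_ne_zero h hd0 key
  · intro h h0
    rw [h0, zero_mul] at key
    exact mul_ne_zero hl h key.symm

/-! ### Shifting the poles of a controller -/

/-- The system `K(σ - ε)`. -/
abbrev shift {m p : ℕ} (K : LTISystem m p) (ε : ℝ) : LTISystem m p where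
  n := K.n
  A := K.A + ε • 1
  B := K.B
  C := K.C
  D := K.D

/-- The substitution `σ ↦ σ - ε` in rational functions. -/
theorem exists_ringHom_X_sub_C (ε : ℝ) : ∃ φ : RatFunc ℝ →+* RatFunc ℝ,
    φ RatFunc.X = RatFunc.X - RatFunc.C ε ∧ ∀ r, φ (RatFunc.C r) = RatFunc.C r := by
  let e := Polynomial.algEquivAevalXAddC (-ε)
  refine ⟨RatFunc.mapRingHom e (nonZeroDivisors_le_comap_nonZeroDivisors_of_injective _
    e.injective), ?_, fun r => ?_⟩
  · have := RatFunc.map_apply_div e (nonZeroDivisors_le_comap_nonZeroDivisors_of_injective _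
      e.injective) Polynomial.X 1
    simp only [map_one, div_one, RatFunc.algebraMap_X] at this
    rw [RatFunc.coe_mapRingHom_eq_coe_map, this]
    simp [e, sub_eq_add_neg]
  · have := RatFunc.map_apply_div e (nonZeroDivisors_le_comap_nonZeroDivisors_of_injective _
      e.injective) (Polynomial.C r) 1
    simp only [map_one, div_one, RatFunc.algebraMap_C] at this
    rw [RatFunc.coe_mapRingHom_eq_coe_map, this]
    simp [e]

theorem exists_transferMatrix_shift_eq {m p : ℕ} (K : LTISystem m p) (ε : ℝ) :
    ∃ φ : RatFunc ℝ →+* RatFunc ℝ, (∀ r, φ (RatFunc.C r) = RatFunc.C r) ∧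
      (K.shift ε).transferMatrix = K.transferMatrix.map φ := by
  obtain ⟨φ, hX, hC⟩ := exists_ringHom_X_sub_C ε
  refine ⟨φ, hC, ?_⟩
  have hmap : ∀ {a b : ℕ} (Y : Matrix (Fin a) (Fin b) ℝ),
      (Y.map RatFunc.C).map φ = Y.map RatFunc.C := fun Y => by
    ext u v
    simp [hC]
  rw [transferMatrix_eq_freqResp, transferMatrix_eq_freqResp, freqResp_map, hmap, hmap, hmap, hmap,
    hX]
  have h : Matrix.scalar (Fin K.n) RatFunc.X - (K.A + ε • 1).map RatFunc.C
      = Matrix.scalar (Fin K.n) (RatFunc.X - RatFunc.C ε) - K.A.map RatFunc.C := by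
    ext u v
    by_cases huv : u = v
    · subst huv; simp; ring
    · simp [huv]
  rw [freqResp, freqResp, ← h]

theorem shift_mem_sparsityConstraint {nu ny : ℕ} {Adm : Finset (Fin nu × Fin ny)}
    {K : LTISystem ny nu} (hK : K ∈ sparsityConstraint Adm) (ε : ℝ) :
    K.shift ε ∈ sparsityConstraint Adm := by
  obtain ⟨φ, -, h⟩ := K.exists_transferMatrix_shift_eq ε
  intro u v huv
  rw [h, Matrix.map_apply, hK u v huv, map_zero]

theorem shift_mem_staticPlus {nu ny : ℕ} {I : Finset (Fin nu × Fin ny)}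
    {K : LTISystem ny nu} (hK : K ∈ staticPlus I) (ε : ℝ) : K.shift ε ∈ staticPlus I := by
  obtain ⟨φ, hC, h⟩ := K.exists_transferMatrix_shift_eq ε
  intro u v huv
  obtain ⟨r, hr⟩ := hK u v huv
  exact ⟨r, by rw [h, Matrix.map_apply, hr, hC]⟩

/-- A generic shift moves the poles of the controller off `l` and keeps `l` out of the closed-loop
spectrum. -/
theorem exists_shift_notMem_eigs {nu ny : ℕ} (P : LTISystem nu ny) (K : LTISystem ny nu) (l : ℂ)
    (hl : l ∉ eigs (closedLoopA P K)) :
    ∃ ε : ℝ, l ∉ eigs (K.shift ε).A ∧ l ∉ eigs (closedLoopA P (K.shift ε)) := by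
  have hinj : Function.Injective (algebraMap ℝ ℂ) := (algebraMap ℝ ℂ).injective
  have hf1 : {ε : ℝ | l ∈ eigs (K.shift ε).A}.Finite := by
    -- the eigenvalues of `A + ε I` are those of `A`, shifted by `ε`
    have hfin := Matrix.finite_spectrum (K.A.map (algebraMap ℝ ℂ))
    refine (hfin.preimage (f := fun ε : ℝ => l - (algebraMap ℝ ℂ ε)) ?_).subset ?_
    · intro a _ b _ hab
      exact hinj (sub_right_injective hab)
    · intro ε hε
      by_contra hne
      have hne' : l - algebraMap ℝ ℂ ε ∉ eigs K.A := hne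
      rw [notMem_eigs_iff] at hne'
      refine (notMem_eigs_iff _ _).2 ?_ hε
      convert hne' using 2
      ext u v
      by_cases huv : u = v
      · subst huv; simp [shift]; ring
      · simp [shift, huv]
  have hf2 : {ε : ℝ | l ∈ eigs (closedLoopA P (K.shift ε))}.Finite := by
    rw [notMem_eigs_iff] at hl
    have hfin := Matrix.finite_setOf_det_add_smul_eq_zero
      (Matrix.scalar (Fin P.n ⊕ Fin K.n) l - (closedLoopA P K).map (algebraMap ℝ ℂ))
      (-Matrix.fromBlocks 0 0 0 1) 0 (by rwa [zero_smul, add_zero])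
    refine (hfin.preimage (f := algebraMap ℝ ℂ) hinj.injOn).subset ?_
    intro ε hε
    by_contra hne
    refine (notMem_eigs_iff _ _).2 ?_ hε
    have hcl : closedLoopA P (K.shift ε)
        = closedLoopA P K + ε • Matrix.fromBlocks 0 0 0 1 := by
      dsimp only [closedLoopA, shift]
      rw [Matrix.fromBlocks_smul, Matrix.fromBlocks_add]
      congr 1
      · simp
      · simp
      · simp
      · abel
    convert hne using 1
    rw [hcl]
    simp only [Set.mem_preimage, Set.mem_ofPred_eq]
    have : (closedLoopA P K + ε • Matrix.fromBlocks 0 0 0 1).map (algebraMap ℝ ℂ)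
        = (closedLoopA P K).map (algebraMap ℝ ℂ)
          + (algebraMap ℝ ℂ ε) • Matrix.fromBlocks 0 0 0 1 := by
      ext (u | u) (v | v)
      · simp
      · simp
      · simp
      · by_cases huv : u = v <;> simp [huv]
    rw [this, smul_neg, sub_add_eq_sub_sub, sub_eq_add_neg _ (_ • _)]
  obtain ⟨ε, hε⟩ := (hf1.union hf2).exists_notMem
  exact ⟨ε, fun h => hε (Or.inl h), fun h => hε (Or.inr h)⟩

/-! ### Making one entry of a controller static -/

/-- The system whose transfer matrix is that of `K` with the `(i, j)` entry replaced by the constant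
`K.D i j + t`; compare `freqResp_fromBlocks`. -/
noncomputable abbrev replaceEntry {m p : ℕ} (K : LTISystem m p) (i : Fin p) (j : Fin m) (t : ℝ) :
    LTISystem m p where
  n := K.n + K.n
  A := (Matrix.fromBlocks K.A 0 0 K.A).submatrix finSumFinEquiv.symm finSumFinEquiv.symm
  B := (Matrix.fromRows K.B (K.B * Matrix.single j j (1 : ℝ))).submatrix finSumFinEquiv.symm id
  C := (Matrix.fromCols K.C (-(Matrix.single i i (1 : ℝ) * K.C))).submatrix id finSumFinEquiv.symm
  D := K.D + t • Matrix.single i j (1 : ℝ)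

theorem freqResp_replaceEntry {m p : ℕ} (K : LTISystem m p) (i : Fin p) (j : Fin m) (t : ℝ)
    {F : Type*} [Field F] (f : ℝ →+* F) (s : F) :
    freqResp s ((K.replaceEntry i j t).A.map f) ((K.replaceEntry i j t).B.map f)
        ((K.replaceEntry i j t).C.map f) ((K.replaceEntry i j t).D.map f)
      = freqResp s (K.A.map f) (K.B.map f) (K.C.map f) (K.D.map f)
        + (f t - (freqResp s (K.A.map f) (K.B.map f) (K.C.map f) (K.D.map f) i j - f (K.D i j)))
          • Matrix.single i j (1 : F) := by
  have hone : ∀ {a b : ℕ} (u : Fin a) (v : Fin b),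
      (Matrix.single u v (1 : ℝ)).map f = Matrix.single u v 1 := fun u v => by
    ext x y
    by_cases h : u = x ∧ v = y <;> simp [Matrix.single, h]
  have hA : ((Matrix.fromBlocks K.A 0 0 K.A).submatrix finSumFinEquiv.symm
        finSumFinEquiv.symm).map f
      = (Matrix.fromBlocks (K.A.map f) 0 0 (K.A.map f)).submatrix
        finSumFinEquiv.symm finSumFinEquiv.symm := by
    rw [← Matrix.submatrix_map, Matrix.fromBlocks_map, Matrix.map_zero f (map_zero f)]
  have hB : ((Matrix.fromRows K.B (K.B * Matrix.single j j (1 : ℝ))).submatrix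
        finSumFinEquiv.symm id).map f
      = (Matrix.fromRows (K.B.map f) (K.B.map f * Matrix.single j j (1 : F))).submatrix
        finSumFinEquiv.symm id := by
    rw [← Matrix.submatrix_map, Matrix.fromRows_map, Matrix.map_mul, hone]
  have hC : ((Matrix.fromCols K.C (-(Matrix.single i i (1 : ℝ) * K.C))).submatrix id
        finSumFinEquiv.symm).map f
      = (Matrix.fromCols (K.C.map f) (-(Matrix.single i i (1 : F) * K.C.map f))).submatrix id
        finSumFinEquiv.symm := by
    rw [← Matrix.submatrix_map, Matrix.fromCols_map, ← hone i i, ← Matrix.map_mul]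
    congr 2
    exact Matrix.map_neg f (map_neg f) _
  have hD : (K.D + t • Matrix.single i j 1).map f = K.D.map f + f t • Matrix.single i j (1 : F) := by
    rw [Matrix.map_add f (map_add f), ← hone i j]
    congr 1
    ext u v
    exact map_mul f _ _
  rw [hA, hB, hC, hD]
  exact (freqResp_reindex finSumFinEquiv.symm s _ _ _ _).trans (freqResp_fromBlocks s _ _ _ _ i j _)

theorem transferMatrix_replaceEntry_same {m p : ℕ} (K : LTISystem m p) (i : Fin p) (j : Fin m)
    (t : ℝ) : (K.replaceEntry i j t).transferMatrix i j = RatFunc.C (K.D i j + t) := by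
  rw [transferMatrix_eq_freqResp, freqResp_replaceEntry]
  simp
  ring

theorem transferMatrix_replaceEntry_of_ne {m p : ℕ} (K : LTISystem m p) (i : Fin p) (j : Fin m)
    (t : ℝ) {u : Fin p} {v : Fin m} (h : (u, v) ≠ (i, j)) :
    (K.replaceEntry i j t).transferMatrix u v = K.transferMatrix u v := by
  have h' : ¬(i = u ∧ j = v) := fun ⟨h1, h2⟩ => h (by rw [h1, h2])
  rw [transferMatrix_eq_freqResp, freqResp_replaceEntry, ← transferMatrix_eq_freqResp]
  simp [h']

theorem notMem_eigs_replaceEntry_A {m p : ℕ} (K : LTISystem m p) (i : Fin p) (j : Fin m) (t : ℝ)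
    {l : ℂ} (hl : l ∉ eigs K.A) : l ∉ eigs (K.replaceEntry i j t).A := by
  rw [notMem_eigs_iff] at hl ⊢
  have h : Matrix.scalar (Fin (K.n + K.n)) l
        - ((Matrix.fromBlocks K.A 0 0 K.A).submatrix finSumFinEquiv.symm
          finSumFinEquiv.symm).map (algebraMap ℝ ℂ)
      = (Matrix.fromBlocks (Matrix.scalar (Fin K.n) l - K.A.map (algebraMap ℝ ℂ)) 0 0
          (Matrix.scalar (Fin K.n) l - K.A.map (algebraMap ℝ ℂ))).submatrix
          finSumFinEquiv.symm finSumFinEquiv.symm := by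
    rw [← Matrix.submatrix_map, Matrix.fromBlocks_map, Matrix.map_zero _ (map_zero _),
      Matrix.scalar_sub_submatrix, Matrix.scalar_sub_fromBlocks_diagonal]
  refine ne_of_eq_of_ne (congrArg Matrix.det h) ?_
  rw [Matrix.det_submatrix_equiv_self, Matrix.det_fromBlocks_zero₂₁]
  exact mul_ne_zero hl hl

/-- If `l` is neither a pole of the controller nor a closed-loop eigenvalue, then a generic constant
in place of one entry of the controller keeps the interconnection well posed and `l` out of the
closed-loop spectrum. -/
theorem exists_replaceEntry_notMem_eigs {nu ny : ℕ} (P : LTISystem nu ny) (K : LTISystem ny nu)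
    (l : ℂ) (i : Fin nu) (j : Fin ny) (hwp : WellPosed P K) (hl : l ∉ eigs K.A)
    (hcl : l ∉ eigs (closedLoopA P K)) :
    ∃ t : ℝ, WellPosed P (K.replaceEntry i j t) ∧
      l ∉ eigs (closedLoopA P (K.replaceEntry i j t)) := by
  have hf1 : {t : ℝ | ¬ WellPosed P (K.replaceEntry i j t)}.Finite := by
    refine (Matrix.finite_setOf_det_add_smul_eq_zero (1 - K.D * P.D)
      (-(Matrix.single i j (1 : ℝ) * P.D)) 0 ?_).subset fun t ht => ?_
    · rw [zero_smul, add_zero]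
      exact ((Matrix.isUnit_iff_isUnit_det _).1 hwp).ne_zero
    · by_contra hne
      apply ht
      rw [WellPosed, Matrix.isUnit_iff_isUnit_det, isUnit_iff_ne_zero]
      have hD : 1 - (K.D + t • Matrix.single i j (1 : ℝ)) * P.D
          = 1 - K.D * P.D + t • -(Matrix.single i j (1 : ℝ) * P.D) := by
        rw [Matrix.add_mul, Matrix.smul_mul, smul_neg, sub_add_eq_sub_sub, sub_eq_add_neg _ (_ • _)]
      exact fun h0 => hne ((congrArg Matrix.det hD).symm.trans h0)
  rw [notMem_eigs_closedLoopA_iff P K l hwp hl] at hcl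
  -- the complex parameter at which the replaced entry takes its old value `K(l) i j`
  set α : ℂ := K.evalAt l i j - algebraMap ℝ ℂ (K.D i j) with hα
  set Y : Matrix (Fin P.n ⊕ Fin nu) (Fin P.n ⊕ Fin nu) ℂ := Matrix.fromBlocks 0 0
    (-(Matrix.single i j (1 : ℂ) * P.C.map (algebraMap ℝ ℂ)))
    (-(Matrix.single i j (1 : ℂ) * P.D.map (algebraMap ℝ ℂ))) with hY
  have hadd : ∀ (G : Matrix (Fin nu) (Fin ny) ℂ) (z : ℂ),
      P.loopAt l (G + z • Matrix.single i j (1 : ℂ)) = P.loopAt l G + z • Y := fun G z =>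
    loopMatrix_add_smul _ _ _ _ _ _ _
  have hev : ∀ t : ℝ, (K.replaceEntry i j t).evalAt l
      = K.evalAt l + (algebraMap ℝ ℂ t - α) • Matrix.single i j (1 : ℂ) := fun t =>
    K.freqResp_replaceEntry i j t (algebraMap ℝ ℂ) l
  have hfin := (Matrix.finite_setOf_det_add_smul_eq_zero
    (P.loopAt l (K.evalAt l) - α • Y) Y α (by rwa [sub_add_cancel])).preimage
    (f := algebraMap ℝ ℂ) (algebraMap ℝ ℂ).injective.injOn
  obtain ⟨t, ht⟩ := (hf1.union hfin).exists_notMem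
  have hwp' : WellPosed P (K.replaceEntry i j t) := by
    by_contra h
    exact ht (Or.inl h)
  refine ⟨t, hwp', ?_⟩
  rw [notMem_eigs_closedLoopA_iff P _ l hwp' (K.notMem_eigs_replaceEntry_A i j t hl), hev, hadd]
  intro h0
  refine ht (Or.inr ?_)
  rw [Set.mem_preimage, Set.mem_ofPred_eq, ← h0, sub_smul _ α]
  congr 1
  abel

end LTISystem

/-! ### Fixed modes -/

theorem mainTheorem4 {nu ny : ℕ} (P : LTISystem nu ny)
    (Adm I : Finset (Fin nu × Fin ny)) (hI : I ⊆ Adm)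
    (i : Fin nu) (j : Fin ny) (hij : (i, j) ∈ Adm \ I) :
    fixedModes P (sparsityConstraint Adm) (staticPlus I)
      = fixedModes P (sparsityConstraint Adm) (staticPlus (insert (i, j) I)) := by
  apply Set.Subset.antisymm
  · intro l hl K hK hwp
    by_contra hne
    obtain ⟨ε, hA, hcl⟩ := LTISystem.exists_shift_notMem_eigs P K l hne
    -- the shift leaves `K.D` unchanged
    have hwp' : WellPosed P (K.shift ε) := hwp
    have hS := LTISystem.shift_mem_sparsityConstraint hK.1 ε
    have hT := LTISystem.shift_mem_staticPlus hK.2 ε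
    obtain ⟨t, hwp'', hcl'⟩ :=
      LTISystem.exists_replaceEntry_notMem_eigs P (K.shift ε) l i j hwp' hA hcl
    refine hcl' (hl _ ⟨fun u v huv => ?_, fun u v huv => ?_⟩ hwp'')
    · have hne' : (u, v) ≠ (i, j) := by
        rintro h
        exact huv (h ▸ (Finset.mem_sdiff.1 hij).1)
      rw [LTISystem.transferMatrix_replaceEntry_of_ne _ _ _ _ hne']
      exact hS u v huv
    · by_cases h : (u, v) = (i, j)
      · obtain ⟨rfl, rfl⟩ := Prod.mk.inj h
        exact ⟨_, LTISystem.transferMatrix_replaceEntry_same _ _ _ _⟩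
      · rw [LTISystem.transferMatrix_replaceEntry_of_ne _ _ _ _ h]
        exact hT u v fun h' => (Finset.mem_insert.1 h').elim h huv
  · intro l hl K hK hwp
    exact hl K ⟨hK.1, fun u v huv => hK.2 u v fun h => huv (Finset.mem_insert_of_mem h)⟩ hwp
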